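/- Let $K$ be a dyadic compactum, i.e. a compact Hausdorff space which is a continuous image of the Cantor cube $2^\kappa=\{0,1\}^\kappa$ (with the product topology) for some cardinal $\kappa$. Suppose that $K$ is not metrizable. Then the Banach space $C(K)$ of real-valued continuous functions on $K$, endowed with the supremum norm, does not have the $c_0$-extension property; that is, there exist a closed subspace $Y$ of $C(K)$ and a bounded linear operator $T:Y\to c_0$ which admits no extension to a bounded linear operator $\tilde T: C(K)\to c_0$. -/

import Mathlib

open scoped ZeroAtInfty

universe u v

/-- The `c₀`-extension property of a real Banach space `X`: every bounded operator from a closed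
subspace of `X` to `c₀` extends to a bounded operator from `X` to `c₀`. Here `c₀` is the space
`C₀(ℕ, ℝ)` of real sequences tending to zero, with the supremum norm (`ℕ` is discrete). -/
def HasC0ExtensionProperty (X : Type*) [NormedAddCommGroup X] [NormedSpace ℝ X] : Prop :=
  ∀ Y : Submodule ℝ X, IsClosed (Y : Set X) → ∀ T : Y →L[ℝ] C₀(ℕ, ℝ),
    ∃ T' : X →L[ℝ] C₀(ℕ, ℝ), ∀ y : Y, T' (y : X) = T y

/-- A compact Hausdorff space `K` is a dyadic compactum if it is a continuous image of a Cantor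
cube `ι → Bool` (product topology of discrete two-point spaces), for some index set `ι`.
The index set may live in any universe. -/
def IsDyadicCompactum (K : Type u) [TopologicalSpace K] [CompactSpace K] [T2Space K] :
    Prop :=
  ∃ (ι : Type v) (f : (ι → Bool) → K), Continuous f ∧ Function.Surjective f

open Set Filter Topology Function

/-! If `f` maps a Cantor cube onto a nonmetrizable `K`, then `f` depends on uncountably many
coordinates. Each such coordinate is read off by a continuous function on `K` once finitely many
others are fixed. A Δ-system argument fixes these simultaneously for uncountably many coordinates
(`exists_uncountable_cube`), giving `Φ : 2^Γ → K` and functions `h γ` on `K` extending the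
coordinates.

With `Γ` cut down to at most continuum size, take almost disjoint infinite sets `A γ ⊆ ℕ` and points
`p n` with `p n γ = 1` iff `n ∈ A γ`. Cluster points of `p n` have at most one nonzero coordinate,
so evaluation at `Φ (p n)` maps into `c₀` the space `Y` of functions vanishing at the images of zero
and the unit vectors. For an extension `T`, each functional `g ↦ T g n - g (Φ (p n))` kills `Y`,
hence all but countably many `h γ` (`countable_coord_ne_zero`). So some `T (h γ)` is the indicator
of the infinite set `A γ`, which is not in `c₀`. -/

/-! ### Δ-systems and free sets -/

/-- The Δ-system lemma for uncountable indexed families of finite sets. -/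
theorem exists_uncountable_delta_system {α β : Type*} [DecidableEq β] {S : Set α}
    (hS : ¬ S.Countable) (F : α → Finset β) :
    ∃ (R : Finset β) (S' : Set α), S' ⊆ S ∧ ¬ S'.Countable ∧
      ∀ i ∈ S', ∀ j ∈ S', i ≠ j → F i ∩ F j = R := by
  obtain ⟨n, hn⟩ : ∃ n, ¬ {i ∈ S | (F i).card = n}.Countable := by
    by_contra! h
    refine hS ((countable_iUnion h).mono fun i hi => ?_)
    simpa using hi
  suffices H : ∀ n (S : Set α) (F : α → Finset β), ¬ S.Countable → (∀ i ∈ S, (F i).card = n) →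
      ∃ (R : Finset β) (S' : Set α), S' ⊆ S ∧ ¬ S'.Countable ∧
      ∀ i ∈ S', ∀ j ∈ S', i ≠ j → F i ∩ F j = R by
    obtain ⟨R, S', h1, h2, h3⟩ := H n _ F hn fun i hi => hi.2
    exact ⟨R, S', fun i hi => (h1 hi).1, h2, h3⟩
  intro n
  induction n with
  | zero =>
    intro S F hS hF
    refine ⟨∅, S, Subset.rfl, hS, fun i hi j hj _ => ?_⟩
    rw [Finset.card_eq_zero.1 (hF i hi), Finset.empty_inter]
  | succ n ih =>
    intro S F hS hF
    -- Either some point lies in uncountably many sets and can be removed from them, or each point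
    -- lies in countably many, and then a countable disjoint subfamily is never maximal.
    by_cases ha : ∃ a, ¬ {i ∈ S | a ∈ F i}.Countable
    · obtain ⟨a, ha⟩ := ha
      obtain ⟨R, S', h1, h2, h3⟩ := ih _ (fun i => (F i).erase a) ha fun i hi => by
        rw [Finset.card_erase_of_mem hi.2, hF i hi.1, Nat.add_sub_cancel]
      refine ⟨insert a R, S', fun i hi => (h1 hi).1, h2, fun i hi j hj hij => ?_⟩
      rw [← h3 i hi j hj hij, Finset.inter_erase, Finset.erase_inter, Finset.erase_idem,
        Finset.insert_erase (Finset.mem_inter.2 ⟨(h1 hi).2, (h1 hj).2⟩)]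
    · push Not at ha
      obtain ⟨M, hM⟩ := zorn_subset
        {T : Set α | T ⊆ S ∧ ∀ i ∈ T, ∀ j ∈ T, i ≠ j → F i ∩ F j = ∅} fun c hc hchain => by
          refine ⟨⋃₀ c, ⟨sUnion_subset fun T hT => (hc hT).1, ?_⟩, fun T => subset_sUnion_of_mem⟩
          rintro i ⟨T, hT, hi⟩ j ⟨T', hT', hj⟩ hij
          rcases hchain.total hT hT' with h | h
          · exact (hc hT').2 i (h hi) j hj hij
          · exact (hc hT).2 i hi j (h hj) hij
      refine ⟨∅, M, hM.prop.1, fun hMc => ?_, hM.prop.2⟩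
      have hc : (M ∪ ⋃ i ∈ M, ⋃ a ∈ F i, {j ∈ S | a ∈ F j}).Countable :=
        hMc.union (hMc.biUnion fun i _ => (F i).countable_toSet.biUnion fun a _ => ha a)
      refine hS (hc.mono fun j hj => ?_)
      by_contra hjM
      simp only [mem_union, mem_iUnion, not_or, not_exists, mem_ofPred_eq, not_and] at hjM
      have hdisj : ∀ i ∈ M, F i ∩ F j = ∅ := fun i hi => by
        ext a
        simp only [Finset.mem_inter, Finset.notMem_empty, iff_false, not_and]
        exact fun h => hjM.2 i hi a h hj
      refine hjM.1 (hM.le_of_ge (y := insert j M) ⟨insert_subset hj hM.prop.1, ?_⟩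
        (subset_insert _ _) (mem_insert _ _))
      rintro i (rfl | hi) k (rfl | hk) hik
      · exact absurd rfl hik
      · rw [Finset.inter_comm, hdisj k hk]
      · exact hdisj i hi
      · exact hM.prop.2 i hi k hk hik

/-- From uncountably many finite partial functions `z i` on `F i`, one can extract an uncountable
free set of indices on which they are all restrictions of a single function. -/
theorem exists_uncountable_free_compatible {ι β : Type*} [Finite β] {S : Set ι}
    (hS : ¬ S.Countable) (F : ι → Finset ι) (z : ι → ι → β) (hF : ∀ i ∈ S, i ∉ F i) :
    ∃ (Γ : Set ι) (w : ι → β), Γ ⊆ S ∧ ¬ Γ.Countable ∧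
      ∀ i ∈ Γ, ∀ j ∈ F i, j ∉ Γ ∧ w j = z i j := by
  classical
  -- Adjoining `i` to `F i` puts into the root every index of `S'` lying in the set of another, so
  -- discarding the finite root leaves a free set.
  obtain ⟨R, S', hS'S, hS', hR⟩ := exists_uncountable_delta_system hS fun i => insert i (F i)
  obtain ⟨t, ht⟩ : ∃ t : R → β, ¬ {i ∈ S' \ R | (fun j : R => z i j) = t}.Countable := by
    by_contra! h
    refine hS' (((countable_iUnion h).union R.countable_toSet).mono fun i hi => ?_)
    by_cases hiR : i ∈ R
    · exact Or.inr hiR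
    · exact Or.inl (mem_iUnion.2 ⟨_, ⟨hi, hiR⟩, rfl⟩)
  set Γ := {i ∈ S' \ R | (fun j : R => z i j) = t}
  have hcompat : ∀ i ∈ Γ, ∀ k ∈ Γ, ∀ j ∈ F i, j ∈ F k → z i j = z k j := by
    intro i hi k hk j hji hjk
    rcases eq_or_ne i k with rfl | hik
    · rfl
    have hj : j ∈ R := by
      rw [← hR i hi.1.1 k hk.1.1 hik]
      simp [hji, hjk]
    exact congrFun (hi.2.trans hk.2.symm) ⟨j, hj⟩
  obtain ⟨i₀, -⟩ : Γ.Nonempty := by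
    by_contra h
    exact ht (by rw [not_nonempty_iff_eq_empty.1 h]; exact countable_empty)
  refine ⟨Γ, fun j => if h : ∃ i ∈ Γ, j ∈ F i then z h.choose j else z i₀ j,
    fun i hi => hS'S hi.1.1, ht, fun i hi j hj => ⟨fun hjΓ => ?_, ?_⟩⟩
  · have hij : i ≠ j := fun h => hF i (hS'S hi.1.1) (h ▸ hj)
    refine hjΓ.1.2 ?_
    rw [Finset.mem_coe, ← hR i hi.1.1 j hjΓ.1.1 hij]
    simp [hj]
  · have h : ∃ i ∈ Γ, j ∈ F i := ⟨i, hi, hj⟩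
    simp only [dif_pos h]
    exact hcompat _ h.choose_spec.1 _ hi _ h.choose_spec.2 hj

/-! ### Uncountable cubes in nonmetrizable dyadic compacta -/

/-- A Hausdorff continuous image of a second countable compact space is metrizable. -/
theorem metrizableSpace_of_surjective {X : Type*} {K : Type*} [TopologicalSpace X] [CompactSpace X]
    [T2Space X] [SecondCountableTopology X] [TopologicalSpace K] [CompactSpace K] [T2Space K]
    {φ : X → K} (hφ : Continuous φ) (hs : Surjective φ) : TopologicalSpace.MetrizableSpace K := by
  -- `C(K, ℝ)` embeds in the separable space `C(X, ℝ)`, so countably many functions separate the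
  -- points of `K`.
  have hiso : Isometry fun g : C(K, ℝ) => g.comp ⟨φ, hφ⟩ := by
    refine Isometry.of_dist_eq fun g g' => le_antisymm ?_ ?_
    · exact (ContinuousMap.dist_le dist_nonneg).2 fun x => ContinuousMap.dist_apply_le_dist (φ x)
    · refine (ContinuousMap.dist_le dist_nonneg).2 fun y => ?_
      obtain ⟨x, rfl⟩ := hs y
      exact ContinuousMap.dist_apply_le_dist (f := g.comp ⟨φ, hφ⟩) (g := g'.comp ⟨φ, hφ⟩) x
  have := hiso.isEmbedding.secondCountableTopology
  refine Metric.PiNatEmbed.TopologicalSpace.MetrizableSpace.of_countable_separating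
    (fun n => ⇑(TopologicalSpace.denseSeq C(K, ℝ) n)) (fun n => ContinuousMap.continuous _) ?_
  intro x y hxy
  by_contra! h
  have heq : (fun g : C(K, ℝ) => g x) = fun g => g y :=
    Continuous.ext_on (TopologicalSpace.denseRange_denseSeq C(K, ℝ))
      (continuous_eval_const x) (continuous_eval_const y)
      (by rintro _ ⟨n, rfl⟩; exact h n)
  obtain ⟨g, hg0, hg1, -⟩ := exists_continuous_zero_one_of_isClosed (isClosed_singleton (x := x))
    (isClosed_singleton (x := y)) (disjoint_singleton.2 hxy)
  have := congrFun heq g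
  simp only [hg0 (mem_singleton x), hg1 (mem_singleton y), Pi.zero_apply, Pi.one_apply] at this
  exact zero_ne_one this

/-- A continuous map on a product is determined by the coordinates on which it depends. -/
theorem eq_of_eqOn_essential {ι β Z : Type*} [DecidableEq ι] [TopologicalSpace β]
    [TopologicalSpace Z] [T2Space Z] {f : (ι → β) → Z} (hf : Continuous f) {x y : ι → β}
    (hxy : ∀ i, (∃ z b, f (update z i b) ≠ f z) → x i = y i) : f x = f y := by
  have hconst : ∀ F : Finset ι, f (F.piecewise y x) = f x := fun F => by
    induction F using Finset.induction_on with
    | empty => simp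
    | insert i F hi ih =>
      rw [Finset.piecewise_insert, ← ih]
      by_cases h : ∃ z b, f (update z i b) ≠ f z
      · rw [← hxy i h, update_eq_self_iff.2]
        simp [hi]
      · push Not at h
        exact h _ _
  have hlim : Tendsto (fun F : Finset ι => F.piecewise y x) atTop (𝓝 y) := by
    refine tendsto_pi_nhds.2 fun i => tendsto_const_nhds.congr' ?_
    filter_upwards [eventually_ge_atTop {i}] with F hF
    rw [Finset.piecewise_eq_of_mem _ _ _ (hF (Finset.mem_singleton_self i))]
  refine tendsto_nhds_unique ?_ ((hf.tendsto y).comp hlim)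
  simp [comp_def, hconst]

/-- If `f` depends on the coordinate `i`, some continuous function on the range of `f` reads off
this coordinate on the points agreeing with a given one at finitely many other coordinates. -/
theorem exists_continuousMap_eq_coord {ι K : Type*} [DecidableEq ι] [TopologicalSpace K]
    [CompactSpace K] [T2Space K] {f : (ι → Bool) → K} (hf : Continuous f) {i : ι}
    (hi : ∃ z b, f (update z i b) ≠ f z) :
    ∃ (F : Finset ι) (z : ι → Bool) (g : C(K, ℝ)), i ∉ F ∧
      ∀ y : ι → Bool, (∀ j ∈ F, y j = z j) → g (f y) = if y i then 1 else 0 := by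
  obtain ⟨z, b, hb⟩ := hi
  have hne : f (update z i false) ≠ f (update z i true) := by
    intro h
    have key : ∀ c, f (update z i c) = f (update z i true) := by
      rintro (_ | _)
      · exact h
      · rfl
    refine hb ?_
    rw [key b, ← key (z i), update_eq_self]
  -- Separating closed neighbourhoods rather than two points makes `g` exactly 0 or 1 on whole
  -- cylinders.
  obtain ⟨_, _, V₀, hV₀, _, _, V₁, hV₁, hc₀, hc₁, -, -, h₀, h₁, hd⟩ := disjoint_nested_nhds hne
  obtain ⟨g, hg0, hg1, -⟩ := exists_continuous_zero_one_of_isClosed hc₀ hc₁ (hd.mono h₀ h₁)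
  have cyl : ∀ (c : Bool) (V : Set K), V ∈ 𝓝 (f (update z i c)) → ∃ F : Finset ι,
      ∀ y : ι → Bool, (∀ j ∈ F, y j = update z i c j) → f y ∈ V := by
    intro c V hV
    have := hf.continuousAt.preimage_mem_nhds hV
    rw [nhds_pi, Filter.mem_pi'] at this
    obtain ⟨F, t, ht, hsub⟩ := this
    refine ⟨F, fun y hy => hsub fun j hj => ?_⟩
    rw [hy j hj]
    exact mem_of_mem_nhds (ht j)
  obtain ⟨F₀, hF₀⟩ := cyl false V₀ hV₀
  obtain ⟨F₁, hF₁⟩ := cyl true V₁ hV₁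
  have agree : ∀ (c : Bool) (y : ι → Bool), (∀ j ∈ (F₀ ∪ F₁).erase i, y j = z j) → y i = c →
      ∀ j ∈ F₀ ∪ F₁, y j = update z i c j := by
    intro c y hy hyi j hj
    rcases eq_or_ne j i with rfl | hji
    · rw [hyi, update_self]
    · rw [update_of_ne hji, hy j (Finset.mem_erase.2 ⟨hji, hj⟩)]
  refine ⟨(F₀ ∪ F₁).erase i, z, g, Finset.notMem_erase _ _, fun y hy => ?_⟩
  cases hyi : y i
  · simpa using hg0 (hF₀ y fun j hj => agree false y hy hyi j (Finset.mem_union_left _ hj))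
  · simpa using hg1 (hF₁ y fun j hj => agree true y hy hyi j (Finset.mem_union_right _ hj))

/-- A nonmetrizable dyadic compactum contains a copy of a Cantor cube of uncountable weight: there
is a map `Φ` from such a cube whose coordinates extend to continuous functions on the compactum. -/
theorem exists_uncountable_cube {ι K : Type*} [TopologicalSpace K] [CompactSpace K] [T2Space K]
    {f : (ι → Bool) → K} (hf : Continuous f) (hs : Surjective f)
    (hmet : ¬ TopologicalSpace.MetrizableSpace K) :
    ∃ (Γ : Set ι) (Φ : (Γ → Bool) → K) (h : Γ → C(K, ℝ)), ¬ Γ.Countable ∧ Continuous Φ ∧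
      ∀ γ x, h γ (Φ x) = if x γ then 1 else 0 := by
  classical
  set S : Set ι := {i | ∃ z b, f (update z i b) ≠ f z}
  have hS : ¬ S.Countable := by
    intro hS
    have := hS.to_subtype
    have hcont : Continuous fun (t : S → Bool) (i : ι) => if h : i ∈ S then t ⟨i, h⟩ else false := by
      refine continuous_pi fun i => ?_
      by_cases h : i ∈ S
      · simpa [h] using continuous_apply (⟨i, h⟩ : S)
      · simpa [h] using continuous_const
    refine hmet (metrizableSpace_of_surjective (hf.comp hcont) fun y => ?_)
    obtain ⟨x, rfl⟩ := hs y
    refine ⟨fun i => x i, eq_of_eqOn_essential hf fun i hi => ?_⟩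
    have hi' : i ∈ S := hi
    simp [hi']
  choose! F z g hF hg using fun i (hi : i ∈ S) => exists_continuousMap_eq_coord hf hi
  obtain ⟨Γ, w, hΓS, hΓ, hw⟩ := exists_uncountable_free_compatible hS F z hF
  -- Coordinates outside `Γ` are frozen at `w`, which agrees with `z γ` on `F γ` for every `γ ∈ Γ`.
  let E : (Γ → Bool) → ι → Bool := fun x i => if h : i ∈ Γ then x ⟨i, h⟩ else w i
  have hE : Continuous E := by
    refine continuous_pi fun i => ?_
    by_cases h : i ∈ Γ
    · simpa [E, h] using continuous_apply (⟨i, h⟩ : Γ)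
    · simpa [E, h] using continuous_const
  refine ⟨Γ, f ∘ E, fun γ => g γ, hΓ, hf.comp hE, fun γ x => ?_⟩
  rw [comp_apply, hg γ (hΓS γ.2) (E x) fun j hj => ?_]
  · simp [E]
  · obtain ⟨hjΓ, hwj⟩ := hw γ γ.2 j hj
    simp [E, hjΓ, hwj]

/-! ### An operator into `c₀` without extension -/

/-- There is an almost disjoint family of infinite subsets of `ℕ` of size continuum. -/
theorem exists_almostDisjoint_family : ∃ A : (ℕ → Bool) → Set ℕ,
    (∀ b, (A b).Infinite) ∧ ∀ b c, b ≠ c → (A b ∩ A c).Finite := by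
  have hlen : ∀ (b c : ℕ → Bool) (k l : ℕ), Encodable.encode ((List.range k).map b) =
      Encodable.encode ((List.range l).map c) → k = l ∧ ∀ i < k, b i = c i := by
    intro b c k l h
    have h := Encodable.encode_injective h
    obtain rfl : k = l := by simpa using congrArg List.length h
    refine ⟨rfl, fun i hi => ?_⟩
    simpa using List.map_inj_left.1 h i (List.mem_range.2 hi)
  -- `A b` codes the initial segments of `b`; distinct branches share only those up to their first
  -- difference.
  refine ⟨fun b => range fun k => Encodable.encode ((List.range k).map b), fun b => ?_, ?_⟩
  · exact infinite_range_of_injective fun k l h => (hlen b b k l h).1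
  · intro b c hbc
    obtain ⟨m, hm⟩ := Function.ne_iff.1 hbc
    refine ((finite_Iic m).image fun k => Encodable.encode ((List.range k).map b)).subset ?_
    rintro _ ⟨⟨k, rfl⟩, ⟨l, hl⟩⟩
    refine ⟨k, ?_, rfl⟩
    by_contra hk
    exact hm ((hlen b c k l hl.symm).2 m (not_le.1 hk))

/-- If finite signed sums of a family of reals are bounded, all but countably many vanish. -/
theorem countable_support_of_sum_abs_le {Γ : Type*} {a : Γ → ℝ} {C : ℝ}
    (h : ∀ J : Finset Γ, ∑ γ ∈ J, |a γ| ≤ C) : {γ | a γ ≠ 0}.Countable := by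
  have := (summable_of_sum_le (fun γ => abs_nonneg (a γ)) h).countable_support
  simpa [Function.support] using this

section CantorCube

variable {K Γ : Type*} [TopologicalSpace K] [DecidableEq Γ]

/-- The functions vanishing at the images of the zero and of the unit vectors of a Cantor cube. -/
def vanishingSubspace (Φ : (Γ → Bool) → K) : Submodule ℝ C(K, ℝ) where
  carrier := {g | g (Φ fun _ => false) = 0 ∧ ∀ γ, g (Φ fun i => decide (i = γ)) = 0}
  zero_mem' := by simp
  add_mem' := by
    rintro g g' ⟨h, h'⟩ ⟨k, k'⟩
    simp [h, h', k, k']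
  smul_mem' := by
    rintro c g ⟨h, h'⟩
    simp [h, h']

theorem isClosed_vanishingSubspace (Φ : (Γ → Bool) → K) :
    IsClosed (vanishingSubspace Φ : Set C(K, ℝ)) := by
  have : (vanishingSubspace Φ : Set C(K, ℝ)) = {g | g (Φ fun _ => false) = 0} ∩
      ⋂ γ, {g | g (Φ fun i => decide (i = γ)) = 0} := by
    ext g
    simp [vanishingSubspace]
  rw [this]
  exact (isClosed_eq (continuous_eval_const _) continuous_const).inter
    (isClosed_iInter fun γ =>
      isClosed_eq (continuous_eval_const _) continuous_const)

/-- A sequence in a Cantor cube whose coordinates are almost disjoint sets accumulates only at the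
zero and unit vectors. -/
theorem tendsto_zero_of_mem_vanishingSubspace {Φ : (Γ → Bool) → K} (hΦ : Continuous Φ)
    {A : Γ → Set ℕ} (hA : ∀ γ γ', γ ≠ γ' → (A γ ∩ A γ').Finite) {p : ℕ → Γ → Bool}
    (hp : ∀ n γ, p n γ = true ↔ n ∈ A γ) {g : C(K, ℝ)} (hg : g ∈ vanishingSubspace Φ) :
    Tendsto (fun n => g (Φ (p n))) atTop (𝓝 0) := by
  rw [Metric.tendsto_nhds]
  intro ε hε
  by_contra hfreq
  rw [not_eventually] at hfreq
  set C : Set (Γ → Bool) := {x | ¬ dist (g (Φ x)) 0 < ε} with hC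
  have hCc : IsCompact C := IsClosed.isCompact <| by
    simp only [hC, not_lt]
    exact isClosed_le continuous_const ((g.continuous.comp hΦ).dist continuous_const)
  -- Such a cluster point has two coordinates equal to 1, forcing infinitely many `n` into the
  -- intersection of two of the sets `A γ`.
  obtain ⟨x, hxC, hx⟩ := hCc.exists_mapClusterPt_of_frequently hfreq
  have hx0 : x ≠ fun _ => false := by
    rintro rfl
    exact hxC (by simpa [hg.1] using hε)
  have hx1 : ∀ γ, x ≠ fun i => decide (i = γ) := by
    rintro γ rfl
    exact hxC (by simpa [hg.2 γ] using hε)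
  obtain ⟨γ, hγ⟩ : ∃ γ, x γ = true := by
    by_contra! h
    exact hx0 (funext fun i => by simpa using h i)
  obtain ⟨γ', hne, hγ'⟩ : ∃ γ', γ ≠ γ' ∧ x γ' = true := by
    by_contra! h
    refine hx1 γ (funext fun i => ?_)
    rcases eq_or_ne γ i with rfl | hi
    · simpa using hγ
    · simpa [hi.symm] using h i hi
  have hnhds : {y : Γ → Bool | y γ = true ∧ y γ' = true} ∈ 𝓝 x := by
    refine IsOpen.mem_nhds ?_ ⟨hγ, hγ'⟩
    exact ((isOpen_discrete ({true} : Set Bool)).preimage (continuous_apply (A := fun _ : Γ => Bool) γ)).inter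
      ((isOpen_discrete ({true} : Set Bool)).preimage (continuous_apply (A := fun _ : Γ => Bool) γ'))
  have := hx.frequently hnhds
  rw [Nat.frequently_atTop_iff_infinite] at this
  refine this ((hA γ γ' hne).subset fun n hn => ?_)
  exact ⟨(hp n γ).1 hn.1, (hp n γ').1 hn.2⟩

variable [CompactSpace K]

/-- A bounded functional on `C(K)` which vanishes on `vanishingSubspace Φ` vanishes on all but
countably many of the coordinate functions. -/
theorem countable_coord_ne_zero {Φ : (Γ → Bool) → K} {h : Γ → C(K, ℝ)}
    (hh : ∀ γ x, h γ (Φ x) = if x γ then 1 else 0) (φ : C(K, ℝ) →L[ℝ] ℝ)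
    (hφ : ∀ g ∈ vanishingSubspace Φ, φ g = 0) : {γ | φ (h γ) ≠ 0}.Countable := by
  refine countable_support_of_sum_abs_le (C := ‖φ‖) fun J => ?_
  set s : C(K, ℝ) := ∑ γ ∈ J, (SignType.sign (φ (h γ)) : ℝ) • h γ with hs
  -- The norm of `s` may grow with `J`. Truncating to `[-1, 1]` bounds it without changing the
  -- values at the zero and unit vectors, which are 0 or ±1.
  set c : C(K, ℝ) := ⟨fun y => max (-1) (min 1 (s y)), by fun_prop⟩ with hc
  have hsval : ∀ y, s y = ∑ γ ∈ J, (SignType.sign (φ (h γ)) : ℝ) * h γ y := by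
    simp [hs, ContinuousMap.sum_apply]
  have hmem : s - c ∈ vanishingSubspace Φ := by
    refine ⟨?_, fun γ => ?_⟩
    · have : s (Φ fun _ => false) = 0 := by simp [hsval, hh]
      simp [hc, this]
    · have hval : s (Φ fun i => decide (i = γ)) =
          if γ ∈ J then (SignType.sign (φ (h γ)) : ℝ) else 0 := by simp [hsval, hh]
      have : |s (Φ fun i => decide (i = γ))| ≤ 1 := by
        rw [hval]
        split_ifs
        · rcases SignType.sign (φ (h γ)) with _ | _ | _ <;> simp
        · simp
      rw [abs_le] at this
      simp [hc, this.1, this.2]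
  have hnorm : ‖c‖ ≤ 1 := (ContinuousMap.norm_le _ zero_le_one).2 fun y => by
    rw [Real.norm_eq_abs, abs_le]
    exact ⟨le_max_left _ _, max_le (by norm_num) (min_le_left _ _)⟩
  calc ∑ γ ∈ J, |φ (h γ)| = φ s := by
        simp [hs, map_sum, sign_mul_self]
    _ = φ c := by
        have := hφ _ hmem
        rwa [map_sub, sub_eq_zero] at this
    _ ≤ ‖φ c‖ := le_abs_self _
    _ ≤ ‖φ‖ * ‖c‖ := φ.le_opNorm c
    _ ≤ ‖φ‖ := mul_le_of_le_one_right φ.opNorm_nonneg hnorm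

/-- Evaluation along `p` as an operator into `c₀`, on a space of functions tending to zero along
`p`. -/
noncomputable def evalSeq (Y : Submodule ℝ C(K, ℝ)) (q : ℕ → K)
    (hq : ∀ g ∈ Y, Tendsto (fun n => g (q n)) atTop (𝓝 0)) : Y →L[ℝ] C₀(ℕ, ℝ) :=
  LinearMap.mkContinuous
    { toFun := fun g => ⟨⟨fun n => (g : C(K, ℝ)) (q n), continuous_of_discreteTopology⟩, by
        simpa [Nat.cofinite_eq_atTop] using hq g g.2⟩
      map_add' := fun _ _ => rfl
      map_smul' := fun _ _ => rfl } 1 fun g => by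
    rw [one_mul, ← ZeroAtInftyContinuousMap.norm_toBCF_eq_norm]
    exact (BoundedContinuousFunction.norm_le (norm_nonneg _)).2 fun n =>
      (g : C(K, ℝ)).norm_coe_le_norm (q n)

@[simp] theorem evalSeq_apply (Y : Submodule ℝ C(K, ℝ)) (q : ℕ → K)
    (hq : ∀ g ∈ Y, Tendsto (fun n => g (q n)) atTop (𝓝 0)) (g : Y) (n : ℕ) :
    evalSeq Y q hq g n = (g : C(K, ℝ)) (q n) := rfl

/-- If `K` contains a copy of an uncountable Cantor cube, `C(K)` fails the `c₀`-extension
property. -/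
theorem not_hasC0ExtensionProperty_of_cube [Uncountable Γ] {e : Γ → ℕ → Bool} (he : Injective e)
    {Φ : (Γ → Bool) → K} (hΦ : Continuous Φ) {h : Γ → C(K, ℝ)}
    (hh : ∀ γ x, h γ (Φ x) = if x γ then 1 else 0) : ¬ HasC0ExtensionProperty C(K, ℝ) := by
  classical
  intro hext
  obtain ⟨A, hAinf, hAfin⟩ := exists_almostDisjoint_family
  let p : ℕ → Γ → Bool := fun n γ => decide (n ∈ A (e γ))
  obtain ⟨T, hT⟩ := hext (vanishingSubspace Φ) (isClosed_vanishingSubspace Φ)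
    (evalSeq _ (fun n => Φ (p n)) fun g hg => tendsto_zero_of_mem_vanishingSubspace hΦ
      (fun γ γ' hne => hAfin (e γ) (e γ') (he.ne hne)) (by simp [p]) hg)
  have hcount : ∀ n, {γ | T (h γ) n ≠ h γ (Φ (p n))}.Countable := by
    intro n
    let ev : C₀(ℕ, ℝ) →L[ℝ] ℝ := LinearMap.mkContinuous
      { toFun := fun a => a n
        map_add' := fun _ _ => rfl
        map_smul' := fun _ _ => rfl } 1 fun a => by
      rw [one_mul, ← ZeroAtInftyContinuousMap.norm_toBCF_eq_norm]
      exact a.toBCF.norm_coe_le_norm n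
    have := countable_coord_ne_zero hh (ev.comp T - ContinuousMap.evalCLM ℝ (Φ (p n)))
      fun g hg => by
        have := congrArg (fun a : C₀(ℕ, ℝ) => a n) (hT ⟨g, hg⟩)
        rw [evalSeq_apply] at this
        exact sub_eq_zero.2 this
    simpa [ev, sub_eq_zero] using this
  obtain ⟨γ, hγ⟩ : ∃ γ, ∀ n, T (h γ) n = h γ (Φ (p n)) := by
    by_contra! H
    refine not_countable (α := Γ) (countable_univ_iff.1 ((countable_iUnion hcount).mono fun γ _ => ?_))
    simpa using H γ
  have hlim : Tendsto (T (h γ)) atTop (𝓝 0) := by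
    simpa [Nat.cofinite_eq_atTop] using (T (h γ)).zero_at_infty'
  have hlt : ∀ᶠ n in atTop, T (h γ) n < 1 := hlim.eventually (gt_mem_nhds one_pos)
  refine (Nat.frequently_atTop_iff_infinite.2 (hAinf (e γ))) (hlt.mono fun n hn hmem => ?_)
  rw [hγ, hh] at hn
  simp [p, show n ∈ A (e γ) from hmem] at hn

end CantorCube

/-- Every uncountable set has an uncountable subset that injects into `ℕ → Bool`. -/
theorem exists_uncountable_subset_injective {ι : Type*} {S : Set ι} (hS : ¬ S.Countable) :
    ∃ Γ ⊆ S, ¬ Γ.Countable ∧ ∃ e : Γ → ℕ → Bool, Injective e := by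
  have h1 : Cardinal.aleph 1 ≤ Cardinal.mk S := by
    rw [← Cardinal.succ_aleph0, Order.succ_le_iff, ← not_le]
    exact fun h => hS (Cardinal.le_aleph0_iff_set_countable.1 h)
  obtain ⟨Γ, hΓS, hΓ⟩ := Cardinal.le_mk_iff_exists_subset.1 h1
  refine ⟨Γ, hΓS, fun h => ?_, ?_⟩
  · rw [← Cardinal.le_aleph0_iff_set_countable, hΓ] at h
    exact h.not_gt Cardinal.aleph0_lt_aleph_one
  · have h2 : Cardinal.lift.{0} (Cardinal.mk Γ) ≤ Cardinal.lift (Cardinal.mk (ℕ → Bool)) := by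
      rw [hΓ]
      simpa using Cardinal.aleph_one_le_continuum
    obtain ⟨e⟩ := Cardinal.lift_mk_le'.1 h2
    exact ⟨e, e.injective⟩

theorem corollary3p18 (K : Type u) [TopologicalSpace K] [CompactSpace K] [T2Space K]
    (hK : IsDyadicCompactum.{u, v} K) (hmet : ¬ TopologicalSpace.MetrizableSpace K) :
    ¬ HasC0ExtensionProperty C(K, ℝ) := by
  classical
  obtain ⟨ι, f, hf, hs⟩ := hK
  obtain ⟨S, Φ, h, hS, hΦ, hh⟩ := exists_uncountable_cube hf hs hmet
  -- Only continuum many almost disjoint sets are available, so the cube is shrunk to `ℵ₁`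
  -- coordinates.
  obtain ⟨Γ, hΓ, e, he⟩ : ∃ Γ : Set S, ¬ Γ.Countable ∧ ∃ e : Γ → ℕ → Bool, Injective e := by
    obtain ⟨Γ, -, h⟩ := exists_uncountable_subset_injective (S := (univ : Set S))
      fun h => hS (countable_univ_iff.1 h)
    exact ⟨Γ, h⟩
  have : Uncountable Γ := ⟨fun h => hΓ h⟩
  let E : (Γ → Bool) → S → Bool := fun x i => if h : i ∈ Γ then x ⟨i, h⟩ else false
  have hE : Continuous E := by
    refine continuous_pi fun i => ?_
    by_cases h : i ∈ Γ
    · simpa [E, h] using continuous_apply (⟨i, h⟩ : Γ)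
    · simpa [E, h] using continuous_const
  exact not_hasC0ExtensionProperty_of_cube he (hΦ.comp hE) (h := fun γ => h γ)
    fun γ x => by simp [hh, E]
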